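/- Let $M$ be a matroid on a finite linearly ordered set $E$, with set of bases $\mathcal B$ and rank $r=\mathrm{rk}(M)$. For $F\subseteq E$ let $\mathrm{Act}(F)$ be the set of all $e\in E$ for which there is a circuit $C\subseteq F\cup\{e\}$ of $M$ whose minimum element is $e$, and let $\mathrm{Ext}(F)=\mathrm{Act}(F)\setminus F$. Order $\mathcal B$ by $$A\le B\iff A\subseteq B\cup \mathrm{Ext}(B),$$ and let $L(M)$ be the external lattice, that is, this partially ordered set together with an adjoined minimum element $\hat 0$. Its maximum element is the base $T=E\setminus \mathrm{Act}(E)$. For a finite partially ordered set $P$ with minimum $\hat 0$ and maximum $\hat 1$ write $\mu(P)=\mu_P(\hat 0,\hat 1)$ for its Möbius number. Let $M.T=M/(E\setminus T)$ be the contraction of $M$ to $T$, and $L_F(M.T)$ its lattice of flats, ordered by inclusion. Then $$\mu(L(M))=\begin{cases}(-1)^{r-1}\,\mu(L_F(M.T)) & \text{if } M.T \text{ is loopless},\\ 0 & \text{otherwise.}\end{cases}$$ -/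

import Mathlib

open scoped Matroid

namespace OrderedMatroid

section Activity

/-- `Act M F`: the elements `e` that are active with respect to `F`, i.e. there is a circuit
`C ⊆ F ∪ {e}` of `M` whose minimum is `e`. -/
def Act {α : Type*} [LinearOrder α] (M : Matroid α) (F : Set α) : Set α :=
  {e | ∃ C, M.IsCircuit C ∧ C ⊆ F ∪ {e} ∧ IsLeast C e}

/-- The elements that are externally active with respect to `F`. -/
def Ext {α : Type*} [LinearOrder α] (M : Matroid α) (F : Set α) : Set α :=
  Act M F \ F

/-- `A - Act(A)`; a base of `M` when `A` is spanning. -/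
def MaxBas {α : Type*} [LinearOrder α] (M : Matroid α) (A : Set α) : Set α :=
  A \ Act M A

/-- The maximum base `T` of an ordered matroid. -/
def topBase {α : Type*} [LinearOrder α] (M : Matroid α) : Set α :=
  MaxBas M M.E

theorem act_subset_ground {α : Type*} [LinearOrder α] (M : Matroid α) (F : Set α) :
    Act M F ⊆ M.E := by
  rintro e ⟨C, hC, -, he⟩
  exact hC.subset_ground he.1

theorem mem_closure_of_mem_act {α : Type*} [LinearOrder α] {M : Matroid α} {F : Set α} {e : α}
    (h : e ∈ Act M F) : e ∈ M.closure (F ∩ Set.Ioi e) := by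
  obtain ⟨C, hC, hCF, he⟩ := h
  refine M.closure_subset_closure ?_ (hC.mem_closure_sdiff_singleton_of_mem he.1)
  rintro x ⟨hx, hne⟩
  have hne' : x ≠ e := hne
  refine ⟨?_, lt_of_le_of_ne (he.2 hx) hne'.symm⟩
  rcases hCF hx with h | h
  · exact h
  · exact absurd h hne

theorem mem_act_of_mem_closure {α : Type*} [LinearOrder α] {M : Matroid α} {F : Set α} {e : α}
    (h : e ∈ M.closure (F ∩ Set.Ioi e)) : e ∈ Act M F := by
  have hne : e ∉ F ∩ Set.Ioi e := fun h' => lt_irrefl e h'.2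
  obtain ⟨C, hCF, hC, he⟩ := (Matroid.mem_closure_iff_exists_isCircuit hne).1 h
  refine ⟨C, hC, ?_, he, ?_⟩
  · intro x hx
    rcases hCF hx with h | h
    · exact Or.inr h
    · exact Or.inl h.1
  · intro x hx
    rcases hCF hx with h | h
    · exact le_of_eq h.symm
    · exact le_of_lt h.2

theorem mem_closure_of_mem_union_ext {α : Type*} [LinearOrder α] {M : Matroid α} {B : Set α}
    (hB : B ⊆ M.E) {e : α} (h : e ∈ B ∪ Ext M B) : e ∈ M.closure (B ∩ Set.Ici e) := by
  rcases h with h | h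
  · exact M.mem_closure_of_mem ⟨h, le_refl e⟩ (Set.inter_subset_left.trans hB)
  · exact M.closure_subset_closure (Set.inter_subset_inter_right B Set.Ioi_subset_Ici_self)
      (mem_closure_of_mem_act h.1)

theorem mem_union_ext_of_mem_closure {α : Type*} [LinearOrder α] {M : Matroid α} {B : Set α}
    {e : α} (h : e ∈ M.closure (B ∩ Set.Ici e)) : e ∈ B ∪ Ext M B := by
  by_cases he : e ∈ B
  · exact Or.inl he
  · refine Or.inr ⟨mem_act_of_mem_closure (M.closure_subset_closure ?_ h), he⟩
    rintro x ⟨hx, hle⟩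
    exact ⟨hx, lt_of_le_of_ne hle (fun h' => he (h' ▸ hx))⟩

theorem closure_step {α : Type*} [LinearOrder α] {M : Matroid α} {A B : Set α}
    (hB : B ⊆ M.E) (hAB : A ⊆ B ∪ Ext M B) (e : α) :
    M.closure (A ∩ Set.Ici e) ⊆ M.closure (B ∩ Set.Ici e) := by
  refine M.closure_subset_closure_of_subset_closure ?_
  rintro x ⟨hxA, hx⟩
  exact M.closure_subset_closure
    (Set.inter_subset_inter_right B (Set.Ici_subset_Ici.2 hx))
    (mem_closure_of_mem_union_ext hB (hAB hxA))

theorem ext_trans {α : Type*} [LinearOrder α] {M : Matroid α} {A B C : Set α}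
    (hB : B ⊆ M.E) (hC : C ⊆ M.E) (hAB : A ⊆ B ∪ Ext M B) (hBC : B ⊆ C ∪ Ext M C) :
    A ⊆ C ∪ Ext M C := fun e he =>
  mem_union_ext_of_mem_closure
    (closure_step hC hBC e (mem_closure_of_mem_union_ext hB (hAB he)))

theorem ext_antisymm {α : Type*} [LinearOrder α] {M : Matroid α} {A B : Set α}
    (hA : M.IsBase A) (hB : M.IsBase B) (hAB : A ⊆ B ∪ Ext M B) (hBA : B ⊆ A ∪ Ext M A) :
    A = B := by
  refine hA.eq_of_subset_isBase hB fun a ha => ?_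
  by_contra haB
  have h1 : a ∈ Ext M B := (hAB ha).resolve_left haB
  have h2 : a ∈ M.closure (A ∩ Set.Ioi a) := by
    refine M.closure_subset_closure_of_subset_closure ?_ (mem_closure_of_mem_act h1.1)
    rintro x ⟨hxB, hx⟩
    exact M.closure_subset_closure
      (Set.inter_subset_inter_right A fun y (hy : x ≤ y) => lt_of_lt_of_le hx hy)
      (mem_closure_of_mem_union_ext hA.subset_ground (hBA hxB))
  refine hA.indep.notMem_closure_sdiff_of_mem ha (M.closure_subset_closure ?_ h2)
  rintro x ⟨hx, hlt⟩
  exact ⟨hx, fun h => (ne_of_gt hlt) h⟩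

theorem mem_closure_topBase {α : Type*} [LinearOrder α] (M : Matroid α) [M.Finite] {e : α}
    (he : e ∈ M.E) : e ∈ M.closure (topBase M ∩ Set.Ici e) := by
  have hwf : M.E.WellFoundedOn (· > ·) := M.ground_finite.wellFoundedOn
  refine hwf.induction (P := fun e => e ∈ M.closure (topBase M ∩ Set.Ici e)) he ?_
  intro e he ih
  have hT : topBase M ∩ Set.Ici e ⊆ M.E := Set.inter_subset_left.trans Set.sdiff_subset
  by_cases hA : e ∈ Act M M.E
  · refine M.closure_subset_closure_of_subset_closure ?_ (mem_closure_of_mem_act hA)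
    rintro x ⟨hxE, hx⟩
    exact M.closure_subset_closure
      (Set.inter_subset_inter_right _ (Set.Ici_subset_Ici.2 (le_of_lt hx))) (ih x hxE hx)
  · exact M.mem_closure_of_mem ⟨⟨he, hA⟩, le_refl e⟩ hT

theorem isBase_topBase {α : Type*} [LinearOrder α] (M : Matroid α) [M.Finite] :
    M.IsBase (topBase M) := by
  rw [Matroid.isBase_iff_indep_closure_eq]
  constructor
  · by_contra hI
    have hd : M.Dep (topBase M) := ⟨hI, Set.sdiff_subset⟩
    obtain ⟨C, hCT, hC⟩ := hd.exists_isCircuit_subset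
    have hfin : C.Finite := M.ground_finite.subset hC.subset_ground
    obtain ⟨e, he, hmin⟩ := Set.exists_min_image C id hfin hC.nonempty
    exact (hCT he).2 ⟨C, hC, hC.subset_ground.trans Set.subset_union_left, he, hmin⟩
  · refine Set.Subset.antisymm (M.closure_subset_ground _) fun e he => ?_
    exact M.closure_subset_closure Set.inter_subset_left (mem_closure_topBase M he)

end Activity

/-- The bases of `M`, to be ordered by the external order. -/
structure ExtBase {α : Type*} (M : Matroid α) where
  carrier : Set α
  isBase : M.IsBase carrier

/-- The external order on bases: `A ≤ B` if and only if `A ⊆ B ∪ Ext(B)`. -/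
instance instPartialOrderExtBase {α : Type*} [LinearOrder α] (M : Matroid α) :
    PartialOrder (ExtBase M) where
  le A B := A.carrier ⊆ B.carrier ∪ Ext M B.carrier
  le_refl _ := Set.subset_union_left
  le_trans _ B C h1 h2 := ext_trans B.isBase.subset_ground C.isBase.subset_ground h1 h2
  le_antisymm := by
    rintro ⟨A, hA⟩ ⟨B, hB⟩ h1 h2
    have h : A = B := ext_antisymm hA hB h1 h2
    subst h
    rfl

instance instOrderTopExtBase {α : Type*} [LinearOrder α] (M : Matroid α) [M.Finite] :
    OrderTop (ExtBase M) where
  top := ⟨topBase M, isBase_topBase M⟩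
  le_top A := fun _ he =>
    mem_union_ext_of_mem_closure (mem_closure_topBase M (A.isBase.subset_ground he))

instance instFiniteExtBase {α : Type*} (M : Matroid α) [M.Finite] : Finite (ExtBase M) := by
  have : Finite (Set.powerset M.E) := M.ground_finite.finite_subsets
  refine Finite.of_injective
    (fun B : ExtBase M => (⟨B.carrier, B.isBase.subset_ground⟩ : Set.powerset M.E)) ?_
  rintro ⟨A, hA⟩ ⟨B, hB⟩ h
  have h' : A = B := congrArg Subtype.val h
  subst h'
  rfl

/-- The external lattice `L(M)`: the bases with the external order and a new minimum adjoined.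
Its maximum is the base `topBase M`. -/
abbrev ExtLattice {α : Type*} (M : Matroid α) : Type _ := WithBot (ExtBase M)

/-- The lattice of flats `L_F(N)`, ordered by inclusion. -/
abbrev FlatLattice {α : Type*} (N : Matroid α) : Type _ := {F : Set α // N.IsFlat F}

instance instBoundedOrderFlatLattice {α : Type*} (N : Matroid α) :
    BoundedOrder (FlatLattice N) where
  top := ⟨N.E, N.ground_isFlat⟩
  le_top F := F.2.subset_ground
  bot := ⟨N.closure ∅, N.isFlat_closure ∅⟩
  bot_le F := (N.closure_subset_closure (Set.empty_subset F.1)).trans F.2.closure.subset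

instance instFiniteFlatLattice {α : Type*} (N : Matroid α) [N.Finite] :
    Finite (FlatLattice N) :=
  (N.ground_finite.finite_subsets.subset fun _ h => Matroid.IsFlat.subset_ground h).to_subtype

open Classical in
/-- The Möbius number `μ(P) = μ_P(0̂, 1̂)` of a finite poset with minimum and maximum. -/
noncomputable def moebius (P : Type*) [PartialOrder P] [BoundedOrder P] [Finite P] : ℤ :=
  letI : Fintype P := Fintype.ofFinite P
  letI : LocallyFiniteOrder P := Fintype.toLocallyFiniteOrder
  IncidenceAlgebra.mu ℤ (⊥ : P) (⊤ : P)

/-- The contraction `M.F` of `M` to `F`: its ground set is `F` (for `F ⊆ E`), and everything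
outside `F` is contracted. -/
abbrev contractTo {α : Type*} (M : Matroid α) (F : Set α) : Matroid α := M ／ (M.E \ F)

/-- The rank of a matroid of finite rank, as a natural number. -/
noncomputable def rk {α : Type*} (M : Matroid α) : ℕ := M.eRank.toNat

end OrderedMatroid

/-!
The proof computes both Möbius numbers as signed counts of spanning sets and compares them.

The tool is a form of Rota's theorem on closure operators (`moebius_eq_sum_fiber`): if weights `h`
on a finite index set, carried to a poset `P` by a map `φ`, satisfy `∑_{φ i ≤ x} h i = [x = 0̂]` for
every `x`, then `μ(P)` is the total weight of the fibre of `φ` over `1̂`.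

* For a loopless matroid `N`, take `φ = closure` on subsets of the ground set, with weight
  `(-1)^|W|`. This gives `μ(L_F(N)) = ∑ (-1)^|W|` over the spanning sets `W` of `N`
  (`moebius_flatLattice`). If `N` has a loop, adding and removing it shows that the sum vanishes
  (`sum_spanning_eq_zero`).
* For the external lattice, `Y ↦ Y \ Act(Y)` maps spanning sets to bases and is left adjoint to
  `B ↦ B ∪ Ext(B)` (`spanningBase_le_iff`). Weighting `Y` by the Möbius function of the Boolean
  lattice applied to the indicator of spanning sets, the total weight below each base is `1`.
  The fibre over the top base `T` consists of the `Y ⊇ T` (`spanningBase_eq_top_iff`), and its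
  total weight collapses, by inclusion–exclusion, to a sum over the spanning sets
  `Z ⊇ E \ T` (`sum_Icc_sum_powerset`). These are the sets `(E \ T) ∪ W` with `W`
  spanning in the contraction of `M` to `T`.
-/

namespace OrderedMatroid

/-! ### Möbius numbers -/

open Classical in
/-- Rota's theorem on closure operators, in weighted form: the Möbius number is the weight of the
fibre over the maximum, for any weights whose sums over lower sets are those of `μ(0̂, ·)`. -/
theorem moebius_eq_sum_fiber {P ι : Type*} [PartialOrder P] [BoundedOrder P] [Finite P]
    (s : Finset ι) (φ : ι → P) (h : ι → ℤ)
    (hsum : ∀ x, ∑ i ∈ s with φ i ≤ x, h i = if x = ⊥ then 1 else 0) :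
    moebius P = ∑ i ∈ s with φ i = ⊤, h i := by
  let : Fintype P := Fintype.ofFinite P
  let : LocallyFiniteOrder P := Fintype.toLocallyFiniteOrder
  suffices key : ∀ x : P, IncidenceAlgebra.mu ℤ ⊥ x = ∑ i ∈ s with φ i = x, h i from key ⊤
  intro x
  induction x using WellFoundedLT.induction with
  | ind x ih =>
    have h1 := IncidenceAlgebra.sum_Icc_mu_right (𝕜 := ℤ) (⊥ : P) x
    have h2 : ∑ y ∈ Finset.Icc ⊥ x, ∑ i ∈ s with φ i = y, h i = if x = ⊥ then 1 else 0 := by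
      rw [← hsum x, ← Finset.sum_fiberwise_of_maps_to (s := s.filter fun i => φ i ≤ x)
        (t := Finset.Icc ⊥ x) (g := φ) (by simp)]
      refine Finset.sum_congr rfl fun y hy => Finset.sum_congr ?_ fun _ _ => rfl
      ext i
      simp only [Finset.mem_filter, Finset.mem_Icc, bot_le, true_and] at hy ⊢
      exact ⟨fun hi => ⟨⟨hi.1, hi.2.trans_le hy⟩, hi.2⟩, fun hi => ⟨hi.1.1, hi.2⟩⟩
    have h3 : ∀ f : P → ℤ, ∑ y ∈ Finset.Icc ⊥ x, f y = f x + ∑ y ∈ Finset.Ico ⊥ x, f y := by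
      intro f
      rw [Finset.Icc_eq_cons_Ico bot_le, Finset.sum_cons]
    rw [h3] at h1 h2
    rw [Finset.sum_congr rfl fun y hy => ih y (Finset.mem_Ico.1 hy).2] at h1
    simp only [@eq_comm _ ⊥ x] at h1
    linarith

open Classical in
/-- The version of `moebius_eq_sum_fiber` for a poset with an adjoined minimum. -/
theorem moebius_withBot_eq_neg_sum_fiber {P ι : Type*} [PartialOrder P] [OrderTop P] [Finite P]
    (s : Finset ι) (φ : ι → P) (h : ι → ℤ) (hsum : ∀ x, ∑ i ∈ s with φ i ≤ x, h i = 1) :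
    moebius (WithBot P) = -∑ i ∈ s with φ i = ⊤, h i := by
  -- The extra index `none` carries the weight `μ(0̂, 0̂) = 1`.
  rw [moebius_eq_sum_fiber (Finset.insertNone s)
    (fun i => i.elim (⊥ : WithBot P) fun i => (φ i : WithBot P))
    (fun i => i.elim 1 fun i => -h i)]
  · rw [Finset.sum_filter, Finset.sum_insertNone, Finset.sum_filter]
    simp only [Option.elim, ← WithBot.coe_top, WithBot.coe_inj, WithBot.bot_ne_coe, if_false,
      zero_add, ← Finset.sum_neg_distrib]
    exact Finset.sum_congr rfl fun i _ => by split_ifs <;> simp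
  · intro x
    rw [Finset.sum_filter, Finset.sum_insertNone]
    induction x using WithBot.recBotCoe with
    | bot => simp
    | coe x =>
      have := hsum x
      rw [Finset.sum_filter] at this
      simp only [Option.elim, bot_le, if_true, WithBot.coe_le_coe, WithBot.coe_ne_bot, if_false]
      rw [← neg_add_cancel (1 : ℤ), add_comm, add_left_inj, ← this, ← Finset.sum_neg_distrib]
      exact Finset.sum_congr rfl fun i _ => by split_ifs <;> simp

/-! ### Alternating sums over subsets -/

theorem sum_Icc_neg_one_pow_card {α : Type*} [DecidableEq α] {A X : Finset α} (h : A ⊆ X) :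
    ∑ Y ∈ Finset.Icc A X, (-1 : ℤ) ^ Y.card = if A = X then (-1) ^ X.card else 0 := by
  rw [Finset.Icc_eq_image_powerset h, Finset.sum_image]
  · have hcard : ∀ Y ∈ (X \ A).powerset,
        (-1 : ℤ) ^ (A ∪ Y).card = (-1) ^ A.card * (-1) ^ Y.card := by
      intro Y hY
      rw [Finset.card_union_of_disjoint, pow_add]
      exact Finset.disjoint_sdiff.mono_right (Finset.mem_powerset.1 hY)
    rw [Finset.sum_congr rfl hcard, ← Finset.mul_sum, Finset.sum_powerset_neg_one_pow_card]
    have : X \ A = ∅ ↔ A = X := by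
      rw [Finset.sdiff_eq_empty_iff_subset]
      exact ⟨fun h' => h.antisymm h', fun h' => h'.ge⟩
    simp only [this]
    split_ifs with hAX
    · simp [hAX]
    · simp
  · intro Y hY Z hZ hYZ
    have hd : ∀ W ∈ (X \ A).powerset, (A ∪ W) \ A = W := fun W hW =>
      Finset.union_sdiff_cancel_left (Finset.disjoint_sdiff.mono_right (Finset.mem_powerset.1 hW))
    rw [← hd Y hY, ← hd Z hZ]
    exact congrArg (· \ A) hYZ

/-- Boolean Möbius inversion, summed over the sets between `T` and `X`. -/
theorem sum_Icc_sum_powerset {α : Type*} [DecidableEq α] {T X : Finset α} (hT : T ⊆ X)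
    (f : Finset α → ℤ) :
    ∑ Y ∈ Finset.Icc T X, (-1 : ℤ) ^ Y.card * ∑ Z ∈ Y.powerset, f Z =
      (-1) ^ X.card * ∑ Z ∈ X.powerset with Z ∪ T = X, f Z := by
  simp only [Finset.mul_sum]
  rw [Finset.sum_comm' (t' := X.powerset) (s' := fun Z => Finset.Icc (Z ∪ T) X),
    Finset.sum_filter]
  · refine Finset.sum_congr rfl fun Z hZ => ?_
    rw [← Finset.sum_mul,
      sum_Icc_neg_one_pow_card (Finset.union_subset (Finset.mem_powerset.1 hZ) hT)]
    split_ifs <;> simp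
  · intro Y Z
    simp only [Finset.mem_Icc, Finset.mem_powerset, Finset.union_subset_iff]
    exact ⟨fun h => ⟨⟨⟨h.2, h.1.1⟩, h.1.2⟩, h.2.trans h.1.2⟩, fun h => ⟨⟨h.1.1.2, h.1.2⟩, h.1.1.1⟩⟩

/-! ### The lattice of flats -/

open Classical in
theorem moebius_flatLattice {α : Type*} (N : Matroid α) [N.Finite] (hN : N.Loopless) :
    moebius (FlatLattice N) =
      ∑ W ∈ N.ground_finite.toFinset.powerset.filter fun W : Finset α => N.Spanning (W : Set α),
        (-1 : ℤ) ^ W.card := by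
  rw [moebius_eq_sum_fiber N.ground_finite.toFinset.powerset
    (fun W => (⟨N.closure W, N.isFlat_closure _⟩ : FlatLattice N)) fun W => (-1 : ℤ) ^ W.card]
  · refine Finset.sum_congr ?_ fun _ _ => rfl
    ext W
    rw [@Finset.mem_filter _ _ (fun _ => propDecidable _), Finset.mem_filter, and_congr_right_iff]
    intro hW
    have hWE : (W : Set α) ⊆ N.E := by simpa using Finset.mem_powerset.1 hW
    rw [N.spanning_iff_closure_eq hWE]
    exact Subtype.ext_iff
  · intro F
    have hF : F.1.Finite := N.ground_finite.subset F.2.subset_ground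
    have hfil : (N.ground_finite.toFinset.powerset.filter fun W : Finset α =>
        (⟨N.closure W, N.isFlat_closure _⟩ : FlatLattice N) ≤ F) = hF.toFinset.powerset := by
      ext W
      simp only [Finset.mem_filter, Finset.mem_powerset, Set.Finite.subset_toFinset]
      constructor
      · rintro ⟨hW, hle⟩
        exact (N.subset_closure _ hW).trans hle
      · intro hW
        exact ⟨hW.trans F.2.subset_ground, (N.closure_subset_closure hW).trans F.2.closure.subset⟩
    rw [hfil, Finset.sum_powerset_neg_one_pow_card]
    have hbot : hF.toFinset = ∅ ↔ F = ⊥ := by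
      rw [Set.Finite.toFinset_eq_empty, Subtype.ext_iff]
      change _ ↔ F.1 = N.closure ∅
      rw [N.closure_empty, N.loops_eq_empty]
    by_cases h : F = ⊥
    · rw [if_pos h, if_pos (hbot.2 h)]
    · rw [if_neg h, if_neg (mt hbot.1 h)]

open Classical in
theorem sum_spanning_eq_zero {α : Type*} (N : Matroid α) [N.Finite] (hN : ¬ N.Loopless) :
    ∑ W ∈ N.ground_finite.toFinset.powerset.filter fun W : Finset α => N.Spanning (W : Set α),
        (-1 : ℤ) ^ W.card = 0 := by
  obtain ⟨e, he⟩ : N.loops.Nonempty := by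
    rw [Set.nonempty_iff_ne_empty]
    exact fun h => hN ⟨h⟩
  have heE : e ∈ N.E := N.closure_subset_ground _ he
  have hins : ∀ W : Set α, N.Spanning (insert e W) ↔ N.Spanning W := by
    intro W
    have hcl : N.closure (insert e W) = N.closure W :=
      Matroid.closure_insert_eq_of_mem_closure (N.closure_subset_closure (Set.empty_subset W) he)
    rw [Matroid.spanning_iff, Matroid.spanning_iff, hcl, Set.insert_subset_iff,
      and_iff_right heE]
  rw [Finset.sum_filter, ← Finset.insert_erase (N.ground_finite.mem_toFinset.2 heE),
    Finset.sum_powerset_insert (Finset.notMem_erase _ _), ← Finset.sum_add_distrib]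
  refine Finset.sum_eq_zero fun W hW => ?_
  have heW : e ∉ W := fun h => Finset.notMem_erase _ _ (Finset.mem_powerset.1 hW h)
  rw [Finset.coe_insert, hins, Finset.card_insert_of_notMem heW]
  split_ifs
  · rw [pow_succ]
    ring
  · rfl

/-! ### Spanning sets and the external order -/

section External

variable {α : Type*} [LinearOrder α] {M : Matroid α} {Y : Set α}

theorem topBase_restrict (hY : Y ⊆ M.E) : topBase (M ↾ Y) = MaxBas M Y := by
  ext e
  simp only [topBase, MaxBas, Matroid.restrict_ground_eq, Set.mem_sdiff, and_congr_right_iff]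
  intro heY
  refine not_congr ⟨?_, ?_⟩
  · rintro ⟨C, hC, hCY, he⟩
    exact ⟨C, ((Matroid.restrict_isCircuit_iff hY).1 hC).1, hCY, he⟩
  · rintro ⟨C, hC, hCY, he⟩
    refine ⟨C, (Matroid.restrict_isCircuit_iff hY).2 ⟨hC, ?_⟩, hCY, he⟩
    exact hCY.trans (Set.union_subset le_rfl (Set.singleton_subset_iff.2 heY))

variable [M.Finite]

theorem isBase_maxBas (hY : M.Spanning Y) : M.IsBase (MaxBas M Y) := by
  have : (M ↾ Y).Finite := ⟨M.ground_finite.subset hY.subset_ground⟩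
  rw [← topBase_restrict hY.subset_ground]
  exact (hY.isBase_restrict_iff.1 (isBase_topBase _)).1

/-- Hence, for spanning `Y`, the base `Y \ Act(Y)` is the greatest base contained in `Y`. -/
theorem subset_maxBas_union_ext (hY : Y ⊆ M.E) : Y ⊆ MaxBas M Y ∪ Ext M (MaxBas M Y) := by
  have : (M ↾ Y).Finite := ⟨M.ground_finite.subset hY⟩
  intro e he
  have h := mem_closure_topBase (M ↾ Y) he
  rw [topBase_restrict hY, Matroid.restrict_closure_eq (R := Y) (X := MaxBas M Y ∩ Set.Ici e) _
    (Set.inter_subset_left.trans Set.sdiff_subset) hY] at h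
  exact mem_union_ext_of_mem_closure h.1

/-- The base `Y \ Act(Y)` determined by a spanning set `Y`. -/
def spanningBase (hY : M.Spanning Y) : ExtBase M := ⟨MaxBas M Y, isBase_maxBas hY⟩

/-- The map from spanning sets to bases is left adjoint to `B ↦ B ∪ Ext(B)`. -/
theorem spanningBase_le_iff (hY : M.Spanning Y) (B : ExtBase M) :
    spanningBase hY ≤ B ↔ Y ⊆ B.carrier ∪ Ext M B.carrier := by
  constructor
  · exact fun h => ext_trans (isBase_maxBas hY).subset_ground B.isBase.subset_ground
      (subset_maxBas_union_ext hY.subset_ground) h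
  · exact fun h => Set.sdiff_subset.trans h

theorem spanningBase_eq_top_iff (hY : M.Spanning Y) : spanningBase hY = ⊤ ↔ topBase M ⊆ Y := by
  constructor
  · intro h
    have h' : MaxBas M Y = topBase M := congrArg ExtBase.carrier h
    rw [← h']
    exact Set.sdiff_subset
  · intro h
    rw [← top_le_iff]
    exact h.trans (subset_maxBas_union_ext hY.subset_ground)

end External

/-! ### The external lattice -/

open Classical in
/-- The Möbius number of the external lattice as a signed count of the spanning sets that contain
the complement of the top base. -/
theorem moebius_extLattice {α : Type*} [LinearOrder α] (M : Matroid α) [M.Finite]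
    {T : Finset α} (hT : (T : Set α) = topBase M) :
    moebius (ExtLattice M) = -((-1) ^ M.ground_finite.toFinset.card *
      ∑ Z ∈ M.ground_finite.toFinset.powerset with Z ∪ T = M.ground_finite.toFinset,
        if M.Spanning (Z : Set α) then (-1 : ℤ) ^ Z.card else 0) := by
  set E := M.ground_finite.toFinset with hE
  have hEM : ∀ Y : Finset α, Y ⊆ E ↔ (Y : Set α) ⊆ M.E := fun Y => by simp [hE]
  have hTE : T ⊆ E := (hEM T).2 (hT ▸ Set.sdiff_subset)
  set f : Finset α → ℤ := fun Z => if M.Spanning (Z : Set α) then (-1 : ℤ) ^ Z.card else 0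
    with hf
  -- The weight of `Y` vanishes unless `Y` is spanning.
  have hweight : ∀ Y ∈ E.powerset, (-1 : ℤ) ^ Y.card * ∑ Z ∈ Y.powerset, f Z ≠ 0 →
      M.Spanning (Y : Set α) := by
    intro Y hY hne
    by_contra hsp
    refine hne (mul_eq_zero_of_right _ (Finset.sum_eq_zero fun Z hZ => if_neg fun h => hsp ?_))
    exact h.superset (Finset.coe_subset.2 (Finset.mem_powerset.1 hZ))
      ((hEM Y).1 (Finset.mem_powerset.1 hY))
  rw [moebius_withBot_eq_neg_sum_fiber
    (E.powerset.filter fun Y : Finset α => M.Spanning (Y : Set α))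
    (fun Y : Finset α => if h : M.Spanning (Y : Set α) then spanningBase h else ⊤)
    (fun Y : Finset α => (-1 : ℤ) ^ Y.card * ∑ Z ∈ Y.powerset, f Z)]
  · rw [← sum_Icc_sum_powerset hTE f, neg_inj]
    refine Finset.sum_subset_zero_on_sdiff ?_ ?_ fun _ _ => rfl
    · intro Y hY
      simp only [Finset.mem_filter, Finset.mem_powerset] at hY
      obtain ⟨⟨hYE, hsp⟩, htop⟩ := hY
      rw [dif_pos hsp, spanningBase_eq_top_iff, ← hT, Finset.coe_subset] at htop
      exact Finset.mem_Icc.2 ⟨htop, hYE⟩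
    · intro Y hY
      obtain ⟨hY, hYn⟩ := Finset.mem_sdiff.1 hY
      obtain ⟨hTY, hYE⟩ := Finset.mem_Icc.1 hY
      by_contra hne
      have hsp := hweight Y (Finset.mem_powerset.2 hYE) hne
      refine hYn (Finset.mem_filter.2 ⟨Finset.mem_filter.2 ⟨Finset.mem_powerset.2 hYE, hsp⟩, ?_⟩)
      rw [dif_pos hsp, spanningBase_eq_top_iff, ← hT, Finset.coe_subset]
      exact hTY
  -- The spanning sets mapped below `B` are those inside `X = B ∪ Ext(B)`, so their weights sum to
  -- the indicator of spanning sets at `X`.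
  · intro B
    have hXE : B.carrier ∪ Ext M B.carrier ⊆ M.E :=
      Set.union_subset B.isBase.subset_ground (Set.sdiff_subset.trans (act_subset_ground M _))
    have hXfin := M.ground_finite.subset hXE
    set X := hXfin.toFinset
    have hXcoe : (X : Set α) = B.carrier ∪ Ext M B.carrier := hXfin.coe_toFinset
    have hXsp : M.Spanning (X : Set α) := by
      rw [hXcoe]
      exact B.isBase.spanning.superset Set.subset_union_left hXE
    have hinv := sum_Icc_sum_powerset (Finset.empty_subset X) f
    have hval : ((-1 : ℤ) ^ X.card * ∑ Z ∈ X.powerset with Z ∪ ∅ = X, f Z) = 1 := by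
      have : (X.powerset.filter fun Z => Z ∪ ∅ = X) = {X} := by
        ext Z
        simp only [Finset.union_empty, Finset.mem_filter, Finset.mem_powerset,
          Finset.mem_singleton]
        exact ⟨fun h => h.2, fun h => ⟨h.le, h⟩⟩
      rw [this, Finset.sum_singleton, hf]
      simp only [hXsp, if_true]
      rw [← mul_pow]
      simp
    refine Eq.trans ?_ (hinv.trans hval)
    refine Finset.sum_subset_zero_on_sdiff ?_ ?_ fun _ _ => rfl
    · intro Y hY
      simp only [Finset.mem_filter, Finset.mem_powerset] at hY
      obtain ⟨⟨hYE, hsp⟩, hle⟩ := hY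
      rw [dif_pos hsp, spanningBase_le_iff, ← hXcoe, Finset.coe_subset] at hle
      exact Finset.mem_Icc.2 ⟨Finset.empty_subset _, hle⟩
    · intro Y hY
      obtain ⟨hY, hYn⟩ := Finset.mem_sdiff.1 hY
      have hYX := (Finset.mem_Icc.1 hY).2
      have hYE : Y ⊆ E := (hEM Y).2 ((Finset.coe_subset.2 hYX).trans (hXcoe.trans_subset hXE))
      by_contra hne
      have hsp := hweight Y (Finset.mem_powerset.2 hYE) hne
      refine hYn (Finset.mem_filter.2 ⟨Finset.mem_filter.2 ⟨Finset.mem_powerset.2 hYE, hsp⟩, ?_⟩)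
      rw [dif_pos hsp, spanningBase_le_iff, ← hXcoe, Finset.coe_subset]
      exact hYX

open Classical in
/-- The spanning sets of `M` containing the complement of `T` correspond to the spanning sets of the
contraction to `T`. -/
theorem sum_spanning_contractTo {α : Type*} [DecidableEq α] (M : Matroid α) {E T : Finset α}
    (hE : (E : Set α) = M.E) (hT : T ⊆ E) :
    ∑ Z ∈ E.powerset with Z ∪ T = E, (if M.Spanning (Z : Set α) then (-1 : ℤ) ^ Z.card else 0) =
      (-1) ^ (E \ T).card * ∑ W ∈ T.powerset.filter
        fun W : Finset α => (contractTo M T).Spanning (W : Set α),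
        (-1 : ℤ) ^ W.card := by
  have hsp : ∀ W ⊆ T, ((contractTo M T).Spanning (W : Set α) ↔
      M.Spanning ((W ∪ E \ T : Finset α) : Set α)) := by
    intro W hW
    rw [Matroid.contract_spanning_iff Set.sdiff_subset, Finset.coe_union, Finset.coe_sdiff, hE,
      and_iff_left]
    exact Set.disjoint_sdiff_right.mono_left (Finset.coe_subset.2 hW)
  rw [Finset.sum_filter (s := T.powerset), Finset.mul_sum]
  symm
  refine Finset.sum_bij' (fun W _ => W ∪ E \ T) (fun Z _ => Z ∩ T) ?_ ?_ ?_ ?_ ?_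
  · intro W hW
    have hW := Finset.mem_powerset.1 hW
    simp only [Finset.mem_filter, Finset.mem_powerset]
    refine ⟨Finset.union_subset (hW.trans hT) Finset.sdiff_subset, ?_⟩
    rw [Finset.union_assoc, Finset.sdiff_union_of_subset hT]
    exact Finset.union_eq_right.2 (hW.trans hT)
  · intro Z _
    exact Finset.mem_powerset.2 Finset.inter_subset_right
  · intro W hW
    have hW := Finset.mem_powerset.1 hW
    rw [Finset.union_inter_distrib_right, Finset.inter_eq_left.2 hW, Finset.sdiff_inter_self,
      Finset.union_empty]
  · intro Z hZ
    simp only [Finset.mem_filter, Finset.mem_powerset] at hZ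
    obtain ⟨hZE, hZT⟩ := hZ
    ext x
    have h1 := @hZE x
    have h2 := Finset.ext_iff.1 hZT x
    simp only [Finset.mem_union, Finset.mem_inter, Finset.mem_sdiff] at h2 ⊢
    tauto
  · intro W hW
    have hW := Finset.mem_powerset.1 hW
    simp only [hsp W hW]
    rw [Finset.card_union_of_disjoint (Finset.disjoint_sdiff.mono_left hW), pow_add]
    split_ifs <;> ring

end OrderedMatroid

open Classical in
theorem mainTheorem3 {α : Type*} [LinearOrder α] (M : Matroid α) [M.Finite] :
    OrderedMatroid.moebius (OrderedMatroid.ExtLattice M) =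
      if (OrderedMatroid.contractTo M (OrderedMatroid.topBase M)).Loopless then
        (((-1 : ℤˣ) ^ ((OrderedMatroid.rk M : ℤ) - 1) : ℤˣ) : ℤ) *
          OrderedMatroid.moebius
            (OrderedMatroid.FlatLattice
              (OrderedMatroid.contractTo M (OrderedMatroid.topBase M)))
      else 0 := by
  have hTE : OrderedMatroid.topBase M ⊆ M.E := Set.sdiff_subset
  obtain ⟨T, hT⟩ := (M.ground_finite.subset hTE).exists_finset_coe
  set E := M.ground_finite.toFinset with hE
  have hEcoe : (E : Set α) = M.E := M.ground_finite.coe_toFinset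
  have hsub : T ⊆ E := by
    rw [← Finset.coe_subset, hT, hEcoe]
    exact hTE
  have hrk : OrderedMatroid.rk M = T.card := by
    rw [OrderedMatroid.rk, ← (OrderedMatroid.isBase_topBase M).encard_eq_eRank, ← hT,
      Set.encard_coe_eq_coe_finsetCard, ENat.toNat_natCast]
  have hground : (OrderedMatroid.contractTo M (OrderedMatroid.topBase M)).ground_finite.toFinset
      = T := by
    rw [← Finset.coe_inj, Set.Finite.coe_toFinset, hT, Matroid.contract_ground,
      Set.sdiff_sdiff_cancel_left hTE]
  have hL := OrderedMatroid.moebius_extLattice M hT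
  rw [← hE, OrderedMatroid.sum_spanning_contractTo M hEcoe hsub, hT] at hL
  -- The total sign is `-(-1)^|E| (-1)^|E \ T| = -(-1)^|T| = (-1)^(r - 1)`.
  have hsign : (-1 : ℤ) ^ E.card = (-1) ^ T.card * (-1) ^ (E \ T).card := by
    rw [← pow_add, add_comm, Finset.card_sdiff_add_card_eq_card hsub]
  have hsq : (-1 : ℤ) ^ (E \ T).card * (-1) ^ (E \ T).card = 1 := by
    rw [← mul_pow]
    simp
  split_ifs with hloop
  · rw [OrderedMatroid.moebius_flatLattice _ hloop, hground, hL, hrk, hsign, zpow_sub_one,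
      zpow_natCast]
    push_cast [inv_neg, inv_one]
    linear_combination (-(-1 : ℤ) ^ T.card * ∑ W ∈ T.powerset.filter fun W : Finset α =>
      (OrderedMatroid.contractTo M (OrderedMatroid.topBase M)).Spanning (W : Set α),
        (-1 : ℤ) ^ W.card) * hsq
  · have h0 := OrderedMatroid.sum_spanning_eq_zero _ hloop
    rw [hground] at h0
    rw [hL, h0]
    simp
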